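/- **Theorem (homotopy-based negative condition for graph homomorphisms).** Let $\Gamma$ be an undirected graph without loops (finite or infinite). A *path* in $\Gamma$ is a finite sequence of vertices $(v_0,\dots,v_n)$ with $v_i$ adjacent to $v_{i+1}$ for all $i<n$; its length is $n$. A *$p$-cycle* at a vertex $v$ is a path of length $p$ from $v$ to $v$ (repeated vertices and edges are allowed). Homotopy equivalence of paths is the smallest equivalence relation such that $\sigma\theta\tau$ is equivalent to $\sigma\tau$ whenever $\sigma$ ends at $v$, $\tau$ begins at $v$, and $\theta=(v_0,\dots,v_{2n})$ is a path from $v$ to $v$ that backtracks, i.e. $v_{n-i}=v_{n+i}$ for $0\le i\le n$. For a vertex $v$, let $\pi_1(\Gamma,v)$ be the group of homotopy classes of cycles at $v$ under concatenation, let $N_v$ be the (normal) subgroup generated by the classes of all cycles $\tau\sigma\tau^{-1}$ with $\tau$ a path from $v$ to some vertex $u$ and $\sigma$ a $4$-cycle at $u$, and put $\pi_1^*(\Gamma,v)=\pi_1(\Gamma,v)/N_v$. For a cycle $\gamma$ at $v$, write $\pi_1^*(\gamma)\in\pi_1^*(\Gamma,v)$ for its class and $\gamma^q$ for the concatenation of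 $q$ copies of $\gamma$. Let $F(2^{\mathbb Z^2})=\{x\in\{0,1\}^{\mathbb Z^2} : g\cdot x\ne x \text{ for all } g\in\mathbb Z^2\setminus\{0\}\}$ be the free part of the shift action $(g\cdot x)(h)=x(h+g)$, with the subspace topology of the product topology, regarded as an undirected graph in which $x,y$ are adjacent iff $e\cdot x=y$ or $e\cdot y=x$ for some $e\in\{(1,0),(0,1)\}$. Suppose that for every integer $N>0$ there are relatively prime integers $p,q>N$ such that, for every vertex $v$ and every $p$-cycle $\gamma$ of $\Gamma$ at $v$, the element $\pi_1^*(\gamma^q)$ is not a $p$-th power in $\pi_1^*(\Gamma,v)$. Then there is no graph homomorphism $\varphi\colon F(2^{\mathbb Z^2})\to\Gamma$ that is continuous for the discrete topology on the vertex set of $\Gamma$. -/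

import Mathlib

open SimpleGraph

/-! ### Homotopy of paths in a graph

Paths in the sense of finite sequences of consecutively adjacent vertices (repetitions allowed) are
Mathlib's `SimpleGraph.Walk`s; a `p`-cycle at `v` is a walk from `v` to `v` of length `p`. -/

namespace GraphHomotopy

variable {V : Type*} {Γ : SimpleGraph V}

/-- A back-tracking path `(v₀, …, v₂ₙ)`, `vₙ₋ᵢ = vₙ₊ᵢ` for all `i ≤ n`: a path followed by its
own reverse. -/
def IsBacktracking {v : V} (θ : Γ.Walk v v) : Prop :=
  ∃ (w : V) (ρ : Γ.Walk v w), θ = ρ.append ρ.reverse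

/-- Homotopy equivalence of paths: the smallest equivalence relation which identifies `σ θ τ`
with `σ τ` whenever `θ` is a back-tracking path. -/
inductive Homotopic : {u w : V} → Γ.Walk u w → Γ.Walk u w → Prop
  | backtrack {u v w : V} (σ : Γ.Walk u v) (θ : Γ.Walk v v) (τ : Γ.Walk v w)
      (hθ : IsBacktracking θ) : Homotopic ((σ.append θ).append τ) (σ.append τ)
  | refl {u w : V} (σ : Γ.Walk u w) : Homotopic σ σ
  | symm {u w : V} {σ τ : Γ.Walk u w} : Homotopic σ τ → Homotopic τ σ
  | trans {u w : V} {σ τ ρ : Γ.Walk u w} : Homotopic σ τ → Homotopic τ ρ → Homotopic σ ρ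

theorem IsBacktracking.reverse {v : V} {θ : Γ.Walk v v} (h : IsBacktracking θ) :
    IsBacktracking θ.reverse := by
  obtain ⟨w, ρ, rfl⟩ := h
  exact ⟨w, ρ, by simp⟩

theorem Homotopic.append_left {u v w : V} (ρ : Γ.Walk u v) {σ τ : Γ.Walk v w}
    (h : Homotopic σ τ) : Homotopic (ρ.append σ) (ρ.append τ) := by
  induction h generalizing u with
  | backtrack σ θ τ hθ => simpa [Walk.append_assoc] using Homotopic.backtrack (ρ.append σ) θ τ hθ
  | refl σ => exact .refl _
  | symm _ ih => exact (ih ρ).symm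
  | trans _ _ ih₁ ih₂ => exact (ih₁ ρ).trans (ih₂ ρ)

theorem Homotopic.append_right {u v w : V} {σ τ : Γ.Walk u v} (h : Homotopic σ τ)
    (ρ : Γ.Walk v w) : Homotopic (σ.append ρ) (τ.append ρ) := by
  induction h with
  | backtrack σ θ τ hθ =>
    simpa [Walk.append_assoc] using Homotopic.backtrack σ θ (τ.append ρ) hθ
  | refl σ => exact .refl _
  | symm _ ih => exact (ih ρ).symm
  | trans _ _ ih₁ ih₂ => exact (ih₁ ρ).trans (ih₂ ρ)

theorem Homotopic.append {u v w : V} {σ σ' : Γ.Walk u v} {τ τ' : Γ.Walk v w}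
    (h : Homotopic σ σ') (h' : Homotopic τ τ') : Homotopic (σ.append τ) (σ'.append τ') :=
  (h.append_right τ).trans (h'.append_left σ')

theorem Homotopic.reverse {u w : V} {σ τ : Γ.Walk u w} (h : Homotopic σ τ) :
    Homotopic σ.reverse τ.reverse := by
  induction h with
  | backtrack σ θ τ hθ =>
    simpa [Walk.append_assoc] using
      Homotopic.backtrack τ.reverse θ.reverse σ.reverse hθ.reverse
  | refl σ => exact .refl _
  | symm _ ih => exact ih.symm
  | trans _ _ ih₁ ih₂ => exact ih₁.trans ih₂

/-- `σ⁻¹ σ` is homotopy equivalent to the trivial path. -/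
theorem Homotopic.reverse_append_self {v w : V} (σ : Γ.Walk v w) :
    Homotopic (σ.reverse.append σ) .nil := by
  simpa using Homotopic.backtrack .nil (σ.reverse.append σ) .nil ⟨v, σ.reverse, by simp⟩

variable (Γ) in
/-- Homotopy equivalence on the cycles based at `v`. -/
def cycleSetoid (v : V) : Setoid (Γ.Walk v v) where
  r := Homotopic
  iseqv := ⟨.refl, .symm, .trans⟩

variable (Γ) in
/-- The fundamental group `π₁(Γ)` with base point `v`. -/
def Pi1 (v : V) : Type _ := Quotient (cycleSetoid Γ v)

/-- The class `π₁(γ)` of a cycle `γ`. -/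
def pi1 {v : V} (γ : Γ.Walk v v) : Pi1 Γ v := Quotient.mk (cycleSetoid Γ v) γ

/-- The group structure on `π₁(Γ)`: multiplication is concatenation of cycles. -/
instance (v : V) : Group (Pi1 Γ v) where
  mul := Quotient.map₂ Walk.append fun _ _ h _ _ h' => Homotopic.append h h'
  one := pi1 .nil
  inv := Quotient.map Walk.reverse fun _ _ h => Homotopic.reverse h
  mul_assoc := by
    rintro ⟨a⟩ ⟨b⟩ ⟨c⟩
    exact congrArg pi1 (Walk.append_assoc a b c).symm
  one_mul := by
    rintro ⟨a⟩
    exact congrArg pi1 (Walk.nil_append a)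
  mul_one := by
    rintro ⟨a⟩
    exact congrArg pi1 (Walk.append_nil a)
  inv_mul_cancel := by
    rintro ⟨a⟩
    exact Quotient.sound (Homotopic.reverse_append_self a)

theorem pi1_append {v : V} (γ δ : Γ.Walk v v) : pi1 (γ.append δ) = pi1 γ * pi1 δ := rfl

theorem pi1_reverse {v : V} (γ : Γ.Walk v v) : pi1 γ.reverse = (pi1 γ)⁻¹ := rfl

/-- A square-cycle at `v`: a cycle `τ σ τ⁻¹` with `σ` a `4`-cycle. -/
def IsSquareCycle {v : V} (γ : Γ.Walk v v) : Prop :=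
  ∃ (u : V) (τ : Γ.Walk v u) (σ : Γ.Walk u u), σ.length = 4 ∧
    γ = (τ.append σ).append τ.reverse

variable (Γ) in
/-- The subgroup of `π₁(Γ)` generated by the classes of square-cycles. -/
def squareSubgroup (v : V) : Subgroup (Pi1 Γ v) :=
  Subgroup.closure {g | ∃ γ : Γ.Walk v v, IsSquareCycle γ ∧ pi1 γ = g}

instance (v : V) : (squareSubgroup Γ v).Normal := by
  refine ⟨fun n hn g => ?_⟩
  induction hn using Subgroup.closure_induction with
  | mem x hx =>
    obtain ⟨_, ⟨u, τ, σ, hσ, rfl⟩, rfl⟩ := hx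
    induction g using Quotient.inductionOn with
    | h α =>
      refine Subgroup.subset_closure ⟨_, ⟨u, α.append τ, σ, hσ, rfl⟩, ?_⟩
      have : ((α.append τ).append σ).append (α.append τ).reverse =
          (α.append ((τ.append σ).append τ.reverse)).append α.reverse := by
        simp [Walk.append_assoc]
      rw [this]
      rfl
  | one => simp
  | mul x y _ _ hx hy => simpa [mul_assoc] using (squareSubgroup Γ v).mul_mem hx hy
  | inv x _ hx => simpa [mul_assoc] using (squareSubgroup Γ v).inv_mem hx

variable (Γ) in
/-- The reduced homotopy group `π₁*(Γ)` with base point `v`. -/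
abbrev ReducedPi1 (v : V) : Type _ := Pi1 Γ v ⧸ squareSubgroup Γ v

/-- The class `π₁*(γ)` of a cycle `γ`. -/
def reducedPi1 {v : V} (γ : Γ.Walk v v) : ReducedPi1 Γ v := QuotientGroup.mk (pi1 γ)

/-- The cycle `γ^q`, the concatenation of `q` copies of `γ`. -/
def cyclePow {v : V} (γ : Γ.Walk v v) : ℕ → Γ.Walk v v
  | 0 => .nil
  | q + 1 => (cyclePow γ q).append γ

end GraphHomotopy

/-! ### The free part of the shift action of `ℤ²` on `2^{ℤ²}` -/

namespace BernoulliShift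

/-- The shift action of `ℤ²` on `2^{ℤ²}`: `(g · x)(h) = x(h + g)`. -/
def shift (g : ℤ × ℤ) (x : ℤ × ℤ → Bool) : ℤ × ℤ → Bool := fun h => x (h + g)

/-- The free part `F(2^{ℤ²})`, which carries the subspace topology of the product topology. -/
abbrev FreePart : Type := {x : ℤ × ℤ → Bool // ∀ g : ℤ × ℤ, g ≠ 0 → shift g x ≠ x}

/-- The undirected Cayley graph on `F(2^{ℤ²})` for the standard generators `(1,0)`, `(0,1)`. -/
def cayleyGraph : SimpleGraph FreePart where
  Adj x y := ∃ g : ℤ × ℤ, (g = (1, 0) ∨ g = (0, 1)) ∧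
    (shift g x.1 = y.1 ∨ shift g y.1 = x.1)
  symm := ⟨fun _ _ ⟨g, hg, h⟩ => ⟨g, hg, h.symm⟩⟩
  loopless := ⟨fun x ⟨g, hg, h⟩ =>
    x.2 g (by rcases hg with rfl | rfl <;> simp) (h.elim id id)⟩

end BernoulliShift

/-! ### Classes of walks and edges in the reduced homotopy group -/

namespace GraphHomotopy

variable {V : Type*} {Γ : SimpleGraph V}

/-! Choose `z` in the free part that is `p`-periodic on a horizontal strip and `q`-periodic on the
strip just below. On a compact set of configurations a continuous `φ` reads only a bounded window.
So along the orbit of `z` its values trace a `p`-cycle `γ` on one row and a `q`-cycle on a lower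
row, and on every row from one to the other they agree at columns `0` and `p * q`. The grid between
these rows is filled by images of unit squares, which are 4-cycles. Hence in `π₁*` the class of
`γ^q` is conjugate to that of `p` turns of the `q`-cycle, and so is a `p`-th power. This happens for
all large `p` and `q`, against the hypothesis.

The algebra is `exists_cycle_pow_eq_of_grid`. The window must be fixed before `p` and `q`, so one
compact set has to contain every such `z`: it is cut out by bounds `4 * L g` on the size of boxes in
which the period `g` fails. `BreaksPeriod.stripPeriodic` places `z` in it, and `exists_window` gives
the window. -/

theorem reducedPi1_append {v : V} (γ δ : Γ.Walk v v) :
    reducedPi1 (γ.append δ) = reducedPi1 γ * reducedPi1 δ := rfl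

theorem reducedPi1_reverse {v : V} (γ : Γ.Walk v v) :
    reducedPi1 γ.reverse = (reducedPi1 γ)⁻¹ := rfl

theorem reducedPi1_cyclePow {v : V} (γ : Γ.Walk v v) (q : ℕ) :
    reducedPi1 (cyclePow γ q) = reducedPi1 γ ^ q := by
  induction q with
  | zero => rfl
  | succ q ih => rw [cyclePow, reducedPi1_append, ih, pow_succ]

theorem reducedPi1_eq_of_homotopic {v : V} {γ δ : Γ.Walk v v} (h : Homotopic γ δ) :
    reducedPi1 γ = reducedPi1 δ :=
  congrArg QuotientGroup.mk (Quotient.sound h : pi1 γ = pi1 δ)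

/-- The class in `π₁*(Γ, v)` of an arbitrary walk in the component of `v`, made into a cycle at `v`
by means of chosen walks from `v` to its end points. -/
noncomputable def basedClass {v a b : V} (h : Γ.Reachable v a) (w : Γ.Walk a b) :
    ReducedPi1 Γ v :=
  reducedPi1 ((h.some.append w).append (h.trans w.reachable).some.reverse)

/-- By proof irrelevance the chosen connecting walk depends only on its end points, so the two
copies at `b` cancel up to homotopy. -/
theorem basedClass_append {v a b c : V} (h : Γ.Reachable v a) (w : Γ.Walk a b)
    (w' : Γ.Walk b c) :
    basedClass h (w.append w') = basedClass h w * basedClass (h.trans w.reachable) w' := by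
  rw [basedClass, basedClass, basedClass, ← reducedPi1_append]
  set T := (h.trans w.reachable).some
  set S := h.some
  set R := ((h.trans w.reachable).trans w'.reachable).some
  refine (reducedPi1_eq_of_homotopic ?_).symm
  simpa [Walk.append_assoc] using Homotopic.append_right
    (Homotopic.append_left (S.append w) (Homotopic.reverse_append_self T)) (w'.append R.reverse)

theorem basedClass_nil {v a : V} (h : Γ.Reachable v a) :
    basedClass h (Walk.nil : Γ.Walk a a) = 1 := by
  have := basedClass_append h (Walk.nil : Γ.Walk a a) Walk.nil
  rwa [Walk.nil_append, left_eq_mul] at this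

theorem basedClass_reverse {v a b : V} (h : Γ.Reachable v a) (w : Γ.Walk a b) :
    basedClass (h.trans w.reachable) w.reverse = (basedClass h w)⁻¹ := by
  rw [basedClass, basedClass, ← reducedPi1_reverse]
  simp [Walk.append_assoc]

theorem basedClass_of_length_four {v a : V} (h : Γ.Reachable v a) (w : Γ.Walk a a)
    (hw : w.length = 4) : basedClass h w = 1 :=
  (QuotientGroup.eq_one_iff _).2 (Subgroup.subset_closure ⟨_, ⟨a, h.some, w, hw, rfl⟩, rfl⟩)

theorem basedClass_cycle {v : V} (h : Γ.Reachable v v) (w : Γ.Walk v v) :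
    basedClass h w = reducedPi1 h.some * reducedPi1 w * (reducedPi1 h.some)⁻¹ := rfl

open Classical in
/-- The class of an edge. -/
noncomputable def edgeClass (Γ : SimpleGraph V) (v a b : V) : ReducedPi1 Γ v :=
  -- The junk value `1` makes this a function of vertices alone, so equal vertices can be rewritten
  -- without transporting walks.
  if h : Γ.Reachable v a ∧ Γ.Adj a b then basedClass h.1 h.2.toWalk else 1

theorem edgeClass_eq {v a b : V} (h : Γ.Reachable v a) (hab : Γ.Adj a b) :
    edgeClass Γ v a b = basedClass h hab.toWalk := dif_pos ⟨h, hab⟩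

theorem edgeClass_symm {v a b : V} (h : Γ.Reachable v a) (hab : Γ.Adj a b) :
    edgeClass Γ v b a = (edgeClass Γ v a b)⁻¹ := by
  rw [edgeClass_eq h hab, edgeClass_eq (h.trans hab.reachable) hab.symm, ← basedClass_reverse]
  rfl

theorem edgeClass_square {v a b c d : V} (h : Γ.Reachable v a) (hab : Γ.Adj a b)
    (hbc : Γ.Adj b c) (had : Γ.Adj a d) (hdc : Γ.Adj d c) :
    edgeClass Γ v a b * edgeClass Γ v b c = edgeClass Γ v a d * edgeClass Γ v d c := by
  have hb := h.trans hab.reachable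
  have hd := h.trans had.reachable
  have hc := hb.trans hbc.reachable
  have key := basedClass_of_length_four h
    (hab.toWalk.append (hbc.toWalk.append (hdc.symm.toWalk.append had.symm.toWalk))) rfl
  rw [basedClass_append, basedClass_append, basedClass_append, ← edgeClass_eq h hab,
    ← edgeClass_eq hb hbc, ← edgeClass_eq hc hdc.symm, ← edgeClass_eq hd had.symm,
    edgeClass_symm hd hdc, edgeClass_symm h had, ← mul_inv_rev, ← mul_assoc] at key
  exact mul_inv_eq_one.1 key

/-! ### Products along the rows of a grid -/

/-- The ordered product `f 0 * f 1 * ⋯ * f (n - 1)`. -/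
def orderedProd {G : Type*} [Monoid G] (f : ℕ → G) : ℕ → G
  | 0 => 1
  | n + 1 => orderedProd f n * f n

theorem orderedProd_add {G : Type*} [Monoid G] (f : ℕ → G) (m n : ℕ) :
    orderedProd f (m + n) = orderedProd f m * orderedProd (fun k => f (m + k)) n := by
  induction n with
  | zero => simp [orderedProd]
  | succ n ih => rw [← add_assoc, orderedProd, ih, orderedProd, mul_assoc]

theorem orderedProd_mul_of_periodic {G : Type*} [Monoid G] {f : ℕ → G} {p : ℕ}
    (hf : ∀ k, f (p + k) = f k) (q : ℕ) : orderedProd f (p * q) = orderedProd f p ^ q := by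
  induction q with
  | zero => simp [orderedProd]
  | succ q ih => rw [mul_add, mul_one, add_comm, orderedProd_add, funext hf, ih, pow_succ']

/-- The separate end point `b` lets the walk be typed as a cycle when `f` returns to its start. -/
theorem exists_walk_basedClass_eq {v : V} (f : ℕ → V) (hf : ∀ k, Γ.Adj (f k) (f (k + 1)))
    (h : Γ.Reachable v (f 0)) (n : ℕ) {b : V} (hb : f n = b) :
    ∃ w : Γ.Walk (f 0) b, w.length = n ∧
      basedClass h w = orderedProd (fun k => edgeClass Γ v (f k) (f (k + 1))) n := by
  induction n generalizing b with
  | zero => subst hb; exact ⟨.nil, rfl, basedClass_nil h⟩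
  | succ n ih =>
    subst hb
    obtain ⟨w, hw, hw'⟩ := ih rfl
    refine ⟨w.append (hf n).toWalk, by simp [hw], ?_⟩
    rw [basedClass_append, hw', orderedProd, ← edgeClass_eq]

/-- Two rows of a commuting ladder whose two sides agree have conjugate products. -/
theorem exists_conj_orderedProd {G : Type*} [Group G] (r c : ℕ → ℕ → G) (m : ℕ)
    (hsq : ∀ i j, r i j * c (i + 1) j = c i j * r i (j + 1)) (l : ℕ)
    (hc : ∀ j < l, c m j = c 0 j) :
    ∃ g : G, orderedProd (fun i => r i l) m = g * orderedProd (fun i => r i 0) m * g⁻¹ := by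
  -- The rung is pushed through the row one square at a time.
  have step : ∀ (j n : ℕ), orderedProd (fun i => r i j) n * c n j =
      c 0 j * orderedProd (fun i => r i (j + 1)) n := by
    intro j n
    induction n with
    | zero => simp [orderedProd]
    | succ n ih =>
      rw [orderedProd, orderedProd, mul_assoc, hsq, ← mul_assoc, ih, mul_assoc]
  induction l with
  | zero => exact ⟨1, by simp⟩
  | succ l ih =>
    obtain ⟨g, hg⟩ := ih fun j hj => hc j (by omega)
    refine ⟨(c 0 l)⁻¹ * g, ?_⟩
    have := step l m
    rw [hc l (by omega), hg] at this
    rw [← inv_mul_eq_iff_eq_mul.2 this]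
    group

/-- A grid in `Γ` whose last row is `p`-periodic, whose first row is `q`-periodic and whose two
sides at distance `p * q` agree yields a `p`-cycle whose `q`-th power is a `p`-th power. -/
theorem exists_cycle_pow_eq_of_grid (f : ℕ → ℕ → V) (hr : ∀ i j, Γ.Adj (f i j) (f (i + 1) j))
    (hc : ∀ i j, Γ.Adj (f i j) (f i (j + 1))) (p q l : ℕ)
    (hp : ∀ i, f (p + i) l = f i l) (hq : ∀ i, f (q + i) 0 = f i 0)
    (hpq : ∀ j ≤ l, f (p * q) j = f 0 j) :
    ∃ (v : V) (γ : Γ.Walk v v), γ.length = p ∧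
      ∃ δ : ReducedPi1 Γ v, δ ^ p = reducedPi1 (cyclePow γ q) := by
  set v := f 0 l
  have hcol : ∀ i j, Γ.Reachable (f i 0) (f i j) := fun i j => by
    induction j with
    | zero => rfl
    | succ j ih => exact ih.trans (hc i j).reachable
  have hrow : ∀ i, Γ.Reachable (f 0 0) (f i 0) := fun i => by
    induction i with
    | zero => rfl
    | succ i ih => exact ih.trans (hr i 0).reachable
  have hreach : ∀ i j, Γ.Reachable v (f i j) := fun i j =>
    (hcol 0 l).symm.trans ((hrow i).trans (hcol i j))
  obtain ⟨γ, hγ, hγ'⟩ := exists_walk_basedClass_eq (fun i => f i l) (fun i => hr i l)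
    (hreach 0 l) p (b := v) (by simpa using hp 0)
  obtain ⟨g, hg⟩ := exists_conj_orderedProd
    (fun i j => edgeClass Γ v (f i j) (f (i + 1) j))
    (fun i j => edgeClass Γ v (f i j) (f i (j + 1))) (p * q)
    (fun i j => edgeClass_square (hreach i j) (hr i j) (hc _ j) (hc i j) (hr i _)) l
    (fun j hj => by simp only [hpq j hj.le, hpq (j + 1) hj])
  have htop := orderedProd_mul_of_periodic (p := p)
    (f := fun i => edgeClass Γ v (f i l) (f (i + 1) l))
    (fun k => by simp only [add_assoc, hp]) q
  have hbot := orderedProd_mul_of_periodic (p := q)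
    (f := fun i => edgeClass Γ v (f i 0) (f (i + 1) 0))
    (fun k => by simp only [add_assoc, hq]) p
  rw [mul_comm q p] at hbot
  rw [htop, hbot, ← hγ', basedClass_cycle, conj_pow, ← conj_pow] at hg
  set T := reducedPi1 (hreach 0 l).some
  set D := orderedProd (fun i => edgeClass Γ v (f i 0) (f (i + 1) 0)) q
  -- `D` is one turn of the first row. Conjugation by `T⁻¹` undoes the chosen walk from `v` to
  -- itself, which need not be trivial.
  refine ⟨v, γ, hγ, T⁻¹ * (g * D * g⁻¹) * T⁻¹⁻¹, ?_⟩
  rw [conj_pow, conj_pow, ← hg, conj_pow, reducedPi1_cyclePow]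
  group

end GraphHomotopy

/-! ### Quantitative failure of periods -/

namespace BernoulliShift

/-- The square box of side `L` with lower left corner `c`. -/
noncomputable def box (c : ℤ × ℤ) (L : ℕ) : Finset (ℤ × ℤ) :=
  Finset.Ico c.1 (c.1 + L) ×ˢ Finset.Ico c.2 (c.2 + L)

theorem mem_box {c t : ℤ × ℤ} {L : ℕ} :
    t ∈ box c L ↔ (c.1 ≤ t.1 ∧ t.1 < c.1 + L) ∧ c.2 ≤ t.2 ∧ t.2 < c.2 + L := by
  simp [box]

/-- `x` violates the period `g` inside every box of side `L`. -/
def BreaksPeriod (x : ℤ × ℤ → Bool) (g : ℤ × ℤ) (L : ℕ) : Prop :=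
  ∀ c, ∃ t ∈ box c L, t + g ∈ box c L ∧ x (t + g) ≠ x t

theorem BreaksPeriod.shift_ne {x : ℤ × ℤ → Bool} {g : ℤ × ℤ} {L : ℕ}
    (h : BreaksPeriod x g L) : shift g x ≠ x := by
  obtain ⟨t, -, -, ht⟩ := h 0
  exact fun he => ht (congrFun he t)

theorem BreaksPeriod.shift {x : ℤ × ℤ → Bool} {g : ℤ × ℤ} {L : ℕ}
    (h : BreaksPeriod x g L) (k : ℤ × ℤ) : BreaksPeriod (shift k x) g L := by
  intro c
  obtain ⟨t, ht, htg, hne⟩ := h (c + k)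
  refine ⟨t - k, ?_, ?_, ?_⟩
  · simp only [mem_box, Prod.fst_add, Prod.snd_add, Prod.fst_sub, Prod.snd_sub] at *; omega
  · simp only [mem_box, Prod.fst_add, Prod.snd_add, Prod.fst_sub, Prod.snd_sub] at *; omega
  · simpa [BernoulliShift.shift, sub_add_eq_add_sub] using hne

/-- For each box the condition is a finite union of clopen sets; the uniform bound `L` is what makes
it closed. -/
theorem isClosed_breaksPeriod (g : ℤ × ℤ) (L : ℕ) :
    IsClosed {x : ℤ × ℤ → Bool | BreaksPeriod x g L} := by
  have : {x : ℤ × ℤ → Bool | BreaksPeriod x g L} =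
      ⋂ c, ⋃ t ∈ (box c L : Set (ℤ × ℤ)), {x | t + g ∈ box c L ∧ x (t + g) ≠ x t} := by
    ext x; simp [BreaksPeriod, and_left_comm]
  rw [this]
  refine isClosed_iInter fun c => (box c L).finite_toSet.isClosed_biUnion fun t _ => ?_
  refine isClosed_const.inter ?_
  exact (isClosed_discrete {b : Bool × Bool | b.1 ≠ b.2}).preimage
    (f := fun x : ℤ × ℤ → Bool => (x (t + g), x t)) (by fun_prop)

/-! ### A hyperaperiodic configuration from 2-adic valuations -/

/-- The parity of the `2`-adic valuation. -/
def valuationParity (k : ℤ) : Bool := decide (Even (padicValInt 2 k))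

theorem valuationParity_two_pow_mul (a : ℕ) {m : ℤ} (hm : Odd m) :
    valuationParity (2 ^ a * m) = decide (Even a) := by
  have h : padicValInt 2 (2 ^ a * m) = a := by
    have hm0 : m ≠ 0 := by rintro rfl; simp at hm
    have h2 : padicValInt 2 m = 0 :=
      padicValInt.eq_zero_of_not_dvd (by simpa [← Int.not_even_iff_odd, even_iff_two_dvd] using hm)
    have h3 : padicValInt 2 (2 ^ a) = a := by
      simp [padicValInt, Int.natAbs_pow]
    rw [padicValInt.mul (by positivity) hm0, h2, h3, add_zero]
  rw [valuationParity, h]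

/-- Every interval of some length depending on `d ≠ 0` contains `k` and `k + d` whose valuations
differ by `e`. -/
theorem exists_valuationParity {d : ℤ} (hd : d ≠ 0) {e : ℕ} (he : 0 < e) :
    ∃ (a s : ℕ), ∀ c : ℤ, ∃ k, (c ≤ k ∧ k < c + s) ∧ (c ≤ k + d ∧ k + d < c + s) ∧
      valuationParity k = decide (Even a) ∧ valuationParity (k + d) = decide (Even (a + e)) := by
  obtain ⟨a, o, ho, hdo⟩ := Nat.exists_eq_two_pow_mul_odd (Int.natAbs_ne_zero.2 hd)
  obtain ⟨o, ho, rfl⟩ : ∃ o : ℤ, Odd o ∧ d = 2 ^ a * o := by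
    rcases Int.natAbs_eq d with h | h
    · exact ⟨o, by exact_mod_cast ho, by rw [h, hdo]; push_cast; rfl⟩
    · exact ⟨-o, by simpa using ho, by rw [h, hdo]; push_cast; ring⟩
  set d := 2 ^ a * o
  set M : ℤ := 2 ^ (a + e + 1) with hM
  have hM0 : 0 < M := by positivity
  refine ⟨a, M.natAbs + 2 * d.natAbs, fun c => ?_⟩
  -- For `k = r + M * m` the sum `k + d` is `2 ^ (a + e) * (2 * m + 1)`, while `k` is `2 ^ a` times
  -- an odd number as `0 < e`. The integer `m` puts `k` in `[c + |d|, c + |d| + M)`, so `k + d` also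
  -- stays in the interval.
  set r : ℤ := 2 ^ a * (2 ^ e - o)
  set m : ℤ := -((r - (c + d.natAbs)) / M)
  have hdiv := Int.emod_add_mul_ediv (r - (c + d.natAbs)) M
  have hlt := Int.emod_lt_of_pos (r - (c + d.natAbs)) hM0
  have hnn := Int.emod_nonneg (r - (c + d.natAbs)) hM0.ne'
  have hk : r + M * m = c + d.natAbs + (r - (c + d.natAbs)) % M := by
    simp only [m]; linarith
  have hodd : Odd ((2 : ℤ) ^ e - o + 2 ^ (e + 1) * m) := by
    have h2 : Even ((2 : ℤ) ^ e) := even_two.pow_of_ne_zero he.ne'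
    have h3 : Even ((2 : ℤ) ^ (e + 1)) := even_two.pow_of_ne_zero (by omega)
    exact (h2.sub_odd ho).add_even (h3.mul_right m)
  refine ⟨r + M * m, by omega, by omega, ?_, ?_⟩
  · rw [← valuationParity_two_pow_mul a hodd]
    congr 1
    simp only [r, hM]; ring
  · rw [← valuationParity_two_pow_mul (a + e) (odd_two_mul_add_one m)]
    congr 1
    simp only [r, hM, d]; ring

theorem exists_valuationParity_ne {d : ℤ} (hd : d ≠ 0) :
    ∃ s : ℕ, ∀ c : ℤ, ∃ k, (c ≤ k ∧ k < c + s) ∧ (c ≤ k + d ∧ k + d < c + s) ∧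
      valuationParity (k + d) ≠ valuationParity k := by
  obtain ⟨a, s, h⟩ := exists_valuationParity hd one_pos
  refine ⟨s, fun c => ?_⟩
  obtain ⟨k, h1, h2, h3, h4⟩ := h c
  refine ⟨k, h1, h2, ?_⟩
  rw [h3, h4]
  by_cases ha : Even a <;> simp [Nat.even_add_one, ha]

theorem exists_valuationParity_eq (d : ℤ) :
    ∃ s : ℕ, ∀ c : ℤ, ∃ k, (c ≤ k ∧ k < c + s) ∧ (c ≤ k + d ∧ k + d < c + s) ∧
      valuationParity (k + d) = valuationParity k := by
  rcases eq_or_ne d 0 with rfl | hd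
  · exact ⟨1, fun c => ⟨c, by simp⟩⟩
  obtain ⟨a, s, h⟩ := exists_valuationParity hd two_pos
  refine ⟨s, fun c => ?_⟩
  obtain ⟨k, h1, h2, h3, h4⟩ := h c
  refine ⟨k, h1, h2, ?_⟩
  simp [h3, h4, Nat.even_add]

/-- A hyperaperiodic element of `2^{ℤ²}`. -/
def hyperaperiodic (t : ℤ × ℤ) : Bool := xor (valuationParity t.1) (valuationParity t.2)

/-- The xor changes when exactly one coordinate's parity does: raising the valuation by 1 flips it
in a direction where `g` is nonzero, and raising by 2 preserves it in the other. -/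
theorem exists_breaksPeriod_hyperaperiodic {g : ℤ × ℤ} (hg : g ≠ 0) :
    ∃ L, BreaksPeriod hyperaperiodic g L := by
  obtain ⟨d, e⟩ := g
  by_cases hd : d = 0
  · have he : e ≠ 0 := by rintro rfl; exact hg (by simp [hd])
    obtain ⟨s, hs⟩ := exists_valuationParity_eq d
    obtain ⟨s', hs'⟩ := exists_valuationParity_ne he
    refine ⟨max s s', fun c => ?_⟩
    obtain ⟨k, h1, h2, h3⟩ := hs c.1
    obtain ⟨k', h1', h2', h3'⟩ := hs' c.2
    refine ⟨(k, k'), ?_, ?_, ?_⟩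
    · rw [mem_box]; dsimp only; omega
    · rw [mem_box]; dsimp only [Prod.mk_add_mk]; omega
    · simpa [hyperaperiodic, h3] using h3'
  · obtain ⟨s, hs⟩ := exists_valuationParity_ne hd
    obtain ⟨s', hs'⟩ := exists_valuationParity_eq e
    refine ⟨max s s', fun c => ?_⟩
    obtain ⟨k, h1, h2, h3⟩ := hs c.1
    obtain ⟨k', h1', h2', h3'⟩ := hs' c.2
    refine ⟨(k, k'), ?_, ?_, ?_⟩
    · rw [mem_box]; dsimp only; omega
    · rw [mem_box]; dsimp only [Prod.mk_add_mk]; omega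
    · simpa [hyperaperiodic, h3'] using h3

/-! ### Periodic strips -/

/-- `x` with the horizontal strip of height `H` above the axis made `p`-periodic and the one below
the axis made `q`-periodic. -/
def stripPeriodic (x : ℤ × ℤ → Bool) (p q H : ℕ) (t : ℤ × ℤ) : Bool :=
  if 0 ≤ t.2 ∧ t.2 < H then x (t.1 % p, t.2)
  else if -H ≤ t.2 ∧ t.2 < 0 then x (t.1 % q, t.2)
  else x t

theorem stripPeriodic_top {x : ℤ × ℤ → Bool} {p q H : ℕ} {t : ℤ × ℤ}
    (h : 0 ≤ t.2 ∧ t.2 < H) : stripPeriodic x p q H t = x (t.1 % p, t.2) := if_pos h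

theorem stripPeriodic_bottom {x : ℤ × ℤ → Bool} {p q H : ℕ} {t : ℤ × ℤ}
    (h : -H ≤ t.2 ∧ t.2 < 0) : stripPeriodic x p q H t = x (t.1 % q, t.2) := by
  rw [stripPeriodic, if_neg (by omega), if_pos h]

theorem stripPeriodic_outside {x : ℤ × ℤ → Bool} {p q H : ℕ} {t : ℤ × ℤ}
    (h : t.2 < -H ∨ H ≤ t.2) : stripPeriodic x p q H t = x t := by
  rw [stripPeriodic, if_neg (by omega), if_neg (by omega)]

/-- A violation of a period in a box where `y` is a translate of `x`. -/
theorem BreaksPeriod.of_translate {x y : ℤ × ℤ → Bool} {g : ℤ × ℤ} {L M : ℕ}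
    (h : BreaksPeriod x g L) {b c : ℤ × ℤ} (k : ℤ × ℤ) (hbc : box b L ⊆ box c M)
    (hxy : ∀ t ∈ box b L, y t = x (t - k)) :
    ∃ t ∈ box c M, t + g ∈ box c M ∧ y (t + g) ≠ y t := by
  obtain ⟨t, ht, htg, hne⟩ := h (b - k)
  have h1 : t + k ∈ box b L := by
    simp only [mem_box, Prod.fst_add, Prod.snd_add, Prod.fst_sub, Prod.snd_sub] at *; omega
  have h2 : t + k + g ∈ box b L := by
    simp only [mem_box, Prod.fst_add, Prod.snd_add, Prod.fst_sub, Prod.snd_sub] at *; omega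
  refine ⟨t + k, hbc h1, hbc h2, ?_⟩
  rw [hxy _ h1, hxy _ h2, add_right_comm]
  simpa using hne

theorem box_subset_box {b c : ℤ × ℤ} {L M : ℕ} (h1 : c.1 ≤ b.1) (h2 : b.1 + L ≤ c.1 + M)
    (h3 : c.2 ≤ b.2) (h4 : b.2 + L ≤ c.2 + M) : box b L ⊆ box c M := by
  intro t ht
  rw [mem_box] at *
  omega

/-- Every interval of length `2 L` contains one of length `L` on which reduction modulo `p ≥ L`
is a translation. -/
theorem exists_emod_eq_sub {p L : ℕ} (hL : L ≤ p) (hp : 0 < p) (c : ℤ) :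
    ∃ b k : ℤ, c ≤ b ∧ b ≤ c + L ∧ ∀ i, b ≤ i → i < b + L → i % p = i - k := by
  have hp' : (0 : ℤ) < p := by exact_mod_cast hp
  have h1 := Int.emod_add_mul_ediv c p
  have h2 := Int.emod_lt_of_pos c hp'
  have h3 := Int.emod_nonneg c hp'.ne'
  have key : ∀ (m i : ℤ), p * m ≤ i → i < p * m + p → i % p = i - p * m := by
    intro m i hi hi'
    rw [← Int.sub_mul_emod_self_left i p m, Int.emod_eq_of_lt] <;> omega
  by_cases hc : c % p + L ≤ p
  · exact ⟨c, p * (c / p), le_rfl, by omega, fun i hi hi' => key _ _ (by omega) (by omega)⟩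
  -- An interval crossing a multiple of `p` is replaced by the one starting there.
  · have : (p : ℤ) * (c / p + 1) = p * (c / p) + p := by ring
    exact ⟨p * (c / p + 1), p * (c / p + 1), by omega, by omega,
      fun i hi hi' => key _ _ (by omega) (by omega)⟩

/-- Every box of side `4 * L` contains one of side `L` on which the new configuration is a translate
of `x`. The bound depends on neither `p`, `q` nor `H`. -/
theorem BreaksPeriod.stripPeriodic {x : ℤ × ℤ → Bool} {g : ℤ × ℤ} {L : ℕ}
    (h : BreaksPeriod x g L) {p q H : ℕ} (hp : H < p) (hq : H < q) :
    BreaksPeriod (stripPeriodic x p q H) g (4 * L) := by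
  intro c
  have outside : ∀ j : ℤ, c.2 ≤ j → j ≤ c.2 + 3 * L → (j + L ≤ -H ∨ H ≤ j) →
      ∃ t ∈ box c (4 * L), t + g ∈ box c (4 * L) ∧
        BernoulliShift.stripPeriodic x p q H (t + g) ≠ BernoulliShift.stripPeriodic x p q H t := by
    intro j hj hj' hjH
    refine h.of_translate (b := (c.1, j)) 0
      (box_subset_box le_rfl (by push_cast; omega) hj (by push_cast; omega))
      fun t ht => ?_
    rw [mem_box] at ht
    dsimp only at ht
    rw [sub_zero, stripPeriodic_outside (by omega)]
  have inside : L ≤ H → ∀ j : ℤ, c.2 ≤ j → j ≤ c.2 + 3 * L →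
      (0 ≤ j ∧ j + L ≤ H ∨ -H ≤ j ∧ j + L ≤ 0) →
      ∃ t ∈ box c (4 * L), t + g ∈ box c (4 * L) ∧
        BernoulliShift.stripPeriodic x p q H (t + g) ≠ BernoulliShift.stripPeriodic x p q H t := by
    intro hL j hj hj' hjH
    rcases hjH with hjH | hjH
    · obtain ⟨b, k, hb, hb', hbk⟩ := exists_emod_eq_sub (hL.trans hp.le) (by omega) c.1
      refine h.of_translate (b := (b, j)) (k, 0)
        (box_subset_box hb (by push_cast; omega) hj (by push_cast; omega))
        fun t ht => ?_
      rw [mem_box] at ht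
      dsimp only at ht
      rw [stripPeriodic_top (by omega), hbk _ ht.1.1 ht.1.2]
      congr 1
      ext <;> simp
    · obtain ⟨b, k, hb, hb', hbk⟩ := exists_emod_eq_sub (hL.trans hq.le) (by omega) c.1
      refine h.of_translate (b := (b, j)) (k, 0)
        (box_subset_box hb (by push_cast; omega) hj (by push_cast; omega))
        fun t ht => ?_
      rw [mem_box] at ht
      dsimp only at ht
      rw [stripPeriodic_bottom (by omega), hbk _ ht.1.1 ht.1.2]
      congr 1
      ext <;> simp
  -- If `L ≤ H`, either the lowest slab of height `L` lies in one region or the region starting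
  -- inside it has room for such a slab. Otherwise the strips have total height below `2 * L`, and
  -- the lowest or the highest slab avoids them.
  by_cases hL : L ≤ H
  · by_cases h1 : c.2 + L ≤ -H
    · exact outside c.2 le_rfl (by omega) (.inl h1)
    by_cases h2 : c.2 < -H
    · exact inside hL (-H) (by omega) (by omega) (.inr (by omega))
    by_cases h3 : c.2 + L ≤ 0
    · exact inside hL c.2 le_rfl (by omega) (.inr (by omega))
    by_cases h4 : c.2 < 0
    · exact inside hL 0 (by omega) (by omega) (.inl (by omega))
    by_cases h5 : c.2 + L ≤ H
    · exact inside hL c.2 le_rfl (by omega) (.inl (by omega))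
    by_cases h6 : c.2 < H
    · exact outside H (by omega) (by omega) (.inr le_rfl)
    · exact outside c.2 le_rfl (by omega) (.inr (by omega))
  · by_cases h1 : c.2 + L ≤ -H
    · exact outside c.2 le_rfl (by omega) (.inl h1)
    · exact outside (c.2 + 3 * L) (by omega) le_rfl (.inr (by omega))

/-! ### Compactness and the final grid -/

/-- A continuous map to a discrete space depends, on a compact set, only on a fixed window. -/
theorem exists_window {V : Type*} [TopologicalSpace V] [DiscreteTopology V] {φ : FreePart → V}
    (hφ : Continuous φ) {K : Set FreePart} (hK : IsCompact K) :
    ∃ n : ℕ, ∀ x ∈ K, ∀ y : FreePart,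
      (∀ t : ℤ × ℤ, |t.1| ≤ n → |t.2| ≤ n → y.1 t = x.1 t) → φ y = φ x := by
  have loc : ∀ x : FreePart, ∃ I : Finset (ℤ × ℤ),
      ∀ y : FreePart, (∀ t ∈ I, y.1 t = x.1 t) → φ y = φ x := by
    intro x
    obtain ⟨U, hU, hUφ⟩ := isOpen_induced_iff.1 ((isOpen_discrete {φ x}).preimage hφ)
    have hxU : x.1 ∈ U := by
      change x ∈ Subtype.val ⁻¹' U
      rw [hUφ]; rfl
    obtain ⟨I, u, hu, hIU⟩ := isOpen_pi_iff.1 hU x.1 hxU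
    refine ⟨I, fun y hy => ?_⟩
    have : y ∈ Subtype.val ⁻¹' U := hIU fun t ht => by rw [hy t ht]; exact (hu t ht).2
    rwa [hUφ] at this
  choose I hI using loc
  obtain ⟨S, -, hS⟩ := hK.elim_nhds_subcover (fun x => {y | ∀ t ∈ I x, y.1 t = x.1 t})
    fun x _ => by
      refine IsOpen.mem_nhds ?_ (fun _ _ => rfl)
      have : {y : FreePart | ∀ t ∈ I x, y.1 t = x.1 t} =
          ⋂ t ∈ (I x : Set (ℤ × ℤ)), {y | y.1 t = x.1 t} := by ext; simp
      rw [this]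
      refine (I x).finite_toSet.isOpen_biInter fun t _ => ?_
      exact (isOpen_discrete {x.1 t}).preimage
        (f := fun y : FreePart => y.1 t) ((continuous_apply t).comp continuous_subtype_val)
  refine ⟨S.sup fun x => (I x).sup fun t => t.1.natAbs + t.2.natAbs, fun x hx y hxy => ?_⟩
  -- Both `x` and `y` agree with the centre `w` on `I w`, so `φ` takes its value at `w` on both.
  obtain ⟨w, hw, hxw⟩ := Set.mem_iUnion₂.1 (hS hx)
  rw [hI w x hxw]
  refine hI w y fun t ht => ?_
  have h1 := Finset.le_sup (f := fun t : ℤ × ℤ => t.1.natAbs + t.2.natAbs) ht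
  have h2 := Finset.le_sup (f := fun x => (I x).sup fun t : ℤ × ℤ => t.1.natAbs + t.2.natAbs) hw
  have h3 := h1.trans h2
  rw [← hxw t ht]
  exact hxy t (abs_le.2 (by omega)) (abs_le.2 (by omega))

/-- The free part is not closed in `2^{ℤ²}`, but these conditions are closed there and already force
freeness. -/
theorem isCompact_breaksPeriod (L : ℤ × ℤ → ℕ) :
    IsCompact {x : FreePart | ∀ g ≠ 0, BreaksPeriod x.1 g (L g)} := by
  rw [Subtype.isCompact_iff]
  have : Subtype.val '' {x : FreePart | ∀ g ≠ 0, BreaksPeriod x.1 g (L g)} =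
      ⋂ g, ⋂ _ : g ≠ 0, {x | BreaksPeriod x g (L g)} := by
    ext x
    simp only [Set.mem_image, Set.mem_iInter, Set.mem_ofPred_eq]
    exact ⟨fun ⟨y, hy, hyx⟩ => hyx ▸ hy, fun h => ⟨⟨x, fun g hg => (h g hg).shift_ne⟩, h, rfl⟩⟩
  rw [this]
  exact (isClosed_iInter fun g => isClosed_iInter fun _ => isClosed_breaksPeriod g _).isCompact

theorem shift_shift (g h : ℤ × ℤ) (x : ℤ × ℤ → Bool) :
    shift g (shift h x) = shift (h + g) x := by
  funext t
  simp only [shift]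
  congr 1
  abel

end BernoulliShift

open BernoulliShift GraphHomotopy in
theorem exists_cycle_pow_eq_of_continuous_hom {V : Type*} [TopologicalSpace V]
    [DiscreteTopology V] {Γ : SimpleGraph V} (φ : cayleyGraph →g Γ) (hφ : Continuous φ) :
    ∃ N : ℕ, 0 < N ∧ ∀ p q : ℕ, N < p → N < q → ∃ (v : V) (γ : Γ.Walk v v), γ.length = p ∧
      ∃ δ : ReducedPi1 Γ v, δ ^ p = reducedPi1 (cyclePow γ q) := by
  have hL : ∀ g : ℤ × ℤ, ∃ L, g ≠ 0 → BreaksPeriod hyperaperiodic g L := fun g => by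
    by_cases hg : g = 0
    · exact ⟨0, fun h => absurd hg h⟩
    · exact (exists_breaksPeriod_hyperaperiodic hg).imp fun _ h _ => h
  choose L hL using hL
  obtain ⟨n, hn⟩ := exists_window hφ (isCompact_breaksPeriod fun g => 4 * L g)
  -- A window of radius `n` has `2 * n + 1` rows, the height given to each strip.
  refine ⟨2 * n + 1, by omega, fun p q hp hq => ?_⟩
  set z := stripPeriodic hyperaperiodic p q (2 * n + 1) with hz
  have hzK : ∀ h g, g ≠ 0 → BreaksPeriod (shift h z) g (4 * L g) :=
    fun h g hg => ((hL g hg).stripPeriodic hp hq).shift h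
  set x : ℤ × ℤ → FreePart := fun h => ⟨shift h z, fun g hg => (hzK h g hg).shift_ne⟩
  have hadj : ∀ h e : ℤ × ℤ, (e = (1, 0) ∨ e = (0, 1)) → Γ.Adj (φ (x h)) (φ (x (h + e))) :=
    fun h e he => φ.map_adj ⟨e, he, .inl (shift_shift e h z)⟩
  have hloc : ∀ h k : ℤ × ℤ, (∀ t : ℤ × ℤ, |t.1| ≤ n → |t.2| ≤ n → z (t + h) = z (t + k)) →
      φ (x h) = φ (x k) := fun h k hhk => hn (x k) (hzK k) (x h) hhk
  -- Heights run from `-n - 1` to `n`: the lowest window fills the `q`-periodic strip, the highest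
  -- the `p`-periodic one.
  refine exists_cycle_pow_eq_of_grid (fun i j => φ (x (i, j - n - 1))) (fun i j => ?_)
    (fun i j => ?_) p q (2 * n + 1) (fun i => ?_) (fun i => ?_) (fun j hj => ?_)
  · simpa using hadj (i, j - n - 1) (1, 0) (.inl rfl)
  · have := hadj (i, j - n - 1) (0, 1) (.inr rfl)
    rw [Prod.mk_add_mk, add_zero, show (j : ℤ) - n - 1 + 1 = (j + 1 : ℕ) - n - 1 by
      push_cast; ring] at this
    exact this
  · refine hloc _ _ fun t h1 h2 => ?_
    rw [abs_le] at h2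
    rw [hz, stripPeriodic_top (by rw [Prod.snd_add]; dsimp only; omega),
      stripPeriodic_top (by rw [Prod.snd_add]; dsimp only; omega)]
    have : (t.1 + ((p + i : ℕ) : ℤ)) % p = (t.1 + i) % p := by
      rw [show t.1 + ((p + i : ℕ) : ℤ) = t.1 + i + p by push_cast; ring, Int.add_emod_right]
    simp only [Prod.fst_add, Prod.snd_add, this]
  · refine hloc _ _ fun t h1 h2 => ?_
    rw [abs_le] at h2
    rw [hz, stripPeriodic_bottom (by rw [Prod.snd_add]; dsimp only; omega),
      stripPeriodic_bottom (by rw [Prod.snd_add]; dsimp only; omega)]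
    have : (t.1 + ((q + i : ℕ) : ℤ)) % q = (t.1 + i) % q := by
      rw [show t.1 + ((q + i : ℕ) : ℤ) = t.1 + i + q by push_cast; ring, Int.add_emod_right]
    simp only [Prod.fst_add, Prod.snd_add, this]
  · refine hloc _ _ fun t h1 h2 => ?_
    rw [abs_le] at h2
    -- An intermediate window may straddle the axis, but each of its rows lies in one strip and both
    -- periods divide `p * q`.
    by_cases hs : 0 ≤ t.2 + ((j : ℤ) - n - 1)
    · rw [hz, stripPeriodic_top (by rw [Prod.snd_add]; dsimp only; omega),
        stripPeriodic_top (by rw [Prod.snd_add]; dsimp only; omega)]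
      have : (t.1 + ((p * q : ℕ) : ℤ)) % p = (t.1 + (0 : ℕ)) % p := by
        push_cast; rw [Int.add_mul_emod_self_left, add_zero]
      simp only [Prod.fst_add, Prod.snd_add, this]
    · rw [hz, stripPeriodic_bottom (by rw [Prod.snd_add]; dsimp only; omega),
        stripPeriodic_bottom (by rw [Prod.snd_add]; dsimp only; omega)]
      have : (t.1 + ((p * q : ℕ) : ℤ)) % q = (t.1 + (0 : ℕ)) % q := by
        push_cast; rw [Int.add_mul_emod_self_right, add_zero]
      simp only [Prod.fst_add, Prod.snd_add, this]

theorem mainTheorem8 {V : Type*} [TopologicalSpace V] [DiscreteTopology V] (Γ : SimpleGraph V)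
    (hΓ : ∀ N : ℕ, 0 < N → ∃ p q : ℕ, N < p ∧ N < q ∧ Nat.Coprime p q ∧
      ∀ (v : V) (γ : Γ.Walk v v), γ.length = p →
        ¬ ∃ δ : GraphHomotopy.ReducedPi1 Γ v,
          δ ^ p = GraphHomotopy.reducedPi1 (GraphHomotopy.cyclePow γ q)) :
    ¬ ∃ φ : BernoulliShift.cayleyGraph →g Γ, Continuous φ := by
  rintro ⟨φ, hφ⟩
  obtain ⟨N, hN, h⟩ := exists_cycle_pow_eq_of_continuous_hom φ hφ
  obtain ⟨p, q, hp, hq, -, hpq⟩ := hΓ N hN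
  obtain ⟨v, γ, hγ, hδ⟩ := h p q hp hq
  exact hpq v γ hγ hδ
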